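/- Write finite sequences of non-negative integers as words. A word $a=(a_1,\dots,a_n)$ is an *ascent sequence* if $a_1=0$ and $a_i\le \mathsf{asc}(a_1,\dots,a_{i-1})+1$ for $1<i\le n$, where $\mathsf{asc}$ counts the indices $j$ with $a_j<a_{j+1}$. A word contains a pattern $p$ if it has a subsequence of the length of $p$ whose entries are in the same relative order (including equalities) as those of $p$; otherwise it avoids $p$. Let $\mathsf{CAsc}_n$ be the set of ascent sequences of length $n$ that avoid $101$, and let $\mathcal S_n(231)$ be the set of permutations of $\{1,\dots,n\}$, in one-line notation, that avoid $231$. For a permutation $\pi=\pi_1\cdots\pi_m$ of $\{1,\dots,m\}$, the site between $\pi_i$ and $\pi_{i+1}$ is *active* if $\pi_i=1$ or the value $\pi_i-1$ occurs to the left of $\pi_i$; the sites before $\pi_1$ and after $\pi_m$ are always active. Label the active sites $0,1,2,\dots$ from left to right. For an ascent sequence $a=(a_1,\dots,a_n)$ define $f_{AS}(a)$ recursively: $f_{AS}(a_1)$ is the permutation $1$, and for $1<k\le n$, $f_{AS}(a_1,\dots,a_k)$ is obtained from $f_{AS}(a_1,\dots,a_{k-1})$ by inserting $k$ at the active site labelled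 $a_k$. **Proposition.** For every $n$, the map $f_{AS}$ is well defined on $\mathsf{CAsc}_n$ (at each step an active site labelled $a_k$ exists) and maps $\mathsf{CAsc}_n$ bijectively onto $\mathcal S_n(231)$. (For $n=0$ both sets are taken to consist of the empty word only, which is mapped to itself.) -/

import Mathlib

/-! Finite sequences of non-negative integers, and permutations of `{1, …, n}` in one-line notation,
are lists of natural numbers. The paper's 1-based position `i` is the list index `i - 1`. -/

namespace AscentSeq

/-- The number of ascents of a sequence: positions `i` with `l_i < l_{i+1}`. -/
def asc (l : List ℕ) : ℕ :=
  ((Finset.range (l.length - 1)).filter (fun i => l.getD i 0 < l.getD (i + 1) 0)).card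

/-- Ascent sequences: the first entry is `0`, and every later entry is at most one more than the
number of ascents of the prefix before it. (The empty sequence qualifies vacuously.) -/
def IsAscentSeq (a : List ℕ) : Prop :=
  (∀ h : 0 < a.length, a[0] = 0) ∧
    ∀ (i : ℕ) (h : i < a.length), 0 < i → a[i] ≤ asc (a.take i) + 1

/-- Two sequences have the same length and the same relative order of entries
(applied to both `(i, j)` and `(j, i)`, the condition also compares equalities). -/
def SameOrder (s p : List ℕ) : Prop :=
  s.length = p.length ∧
    ∀ (i j : ℕ) (hi : i < s.length) (hj : j < s.length) (hi' : i < p.length) (hj' : j < p.length),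
      s[i] < s[j] ↔ p[i] < p[j]

/-- `w` contains the pattern `p`: some subsequence of `w` is in the same relative order as `p`. -/
def ContainsPattern (w p : List ℕ) : Prop :=
  ∃ s : List ℕ, s.Sublist w ∧ SameOrder s p

/-- `CAsc n`: the ascent sequences of length `n` that avoid `101`. -/
def CAsc (n : ℕ) : Set (List ℕ) :=
  {a | a.length = n ∧ IsAscentSeq a ∧ ¬ ContainsPattern a [1, 0, 1]}

/-- One-line notations of the permutations of `{1, …, n}`. -/
def Perms (n : ℕ) : Set (List ℕ) :=
  {w | w.Perm (List.range' 1 n)}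

/-- The permutations of `{1, …, n}` that avoid `231`. -/
def CPerms (n : ℕ) : Set (List ℕ) :=
  {w | w ∈ Perms n ∧ ¬ ContainsPattern w [2, 3, 1]}

/-- Site `i` of `w`, where `0 ≤ i ≤ |w|`, is the gap after the first `i` entries. It is active if it
is the first or the last site, or if the entry `x` just before it is `1` or has `x - 1` somewhere
to its left. -/
def IsActive (w : List ℕ) (i : ℕ) : Prop :=
  i = 0 ∨ i = w.length ∨ w.getD (i - 1) 0 = 1 ∨ w.getD (i - 1) 0 - 1 ∈ w.take (i - 1)

instance (w : List ℕ) : DecidablePred (IsActive w) := fun i => by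
  unfold IsActive; infer_instance

/-- The active sites of `w` from left to right; the one labelled `b` is the entry of index `b`. -/
def activeSites (w : List ℕ) : List ℕ :=
  (List.range (w.length + 1)).filter (fun i => decide (IsActive w i))

/-- Insert the new largest entry `|w| + 1` at the active site of `w` labelled `b`
(the value is irrelevant if there is no such site). -/
def insertMax (w : List ℕ) (b : ℕ) : List ℕ :=
  w.insertIdx ((activeSites w).getD b 0) (w.length + 1)

/-- The map `f_AS`: read `a` from left to right and, at the `k`-th entry `a_k`, insert `k` at the
active site labelled `a_k` of the permutation built so far. Starting from the empty permutation,
whose only site is active with label `0`, the first entry `a_1 = 0` produces the permutation `1`. -/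
def fAS (a : List ℕ) : List ℕ :=
  a.foldl insertMax []

end AscentSeq

namespace AscentSeq

/-! Both classes grow one step at a time, by appending a letter or by inserting a new maximum, and
the two growth rules coincide. In a nonempty 101-avoiding ascent sequence `a` the letters are
exactly `0, …, asc a` (`IsCAsc.mem_iff`). Hence a letter may follow `a ++ [b]` iff it is at most `b`
and may follow `a`, or it is the maximal letter (`IsCAsc.concat_concat_iff`). Inserting the maximum
into a 231-avoider creates no 231 iff everything left of the site is smaller than everything right
of it (`IsSplit`, `insertIdx_mem_cPerms_iff`). Such sites are active. After an insertion at one of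
them, the splitting sites are the old ones up to it and the new end (`isSplit_insert`); the number
of active sites grows by one exactly when the insertion is at the end (`isSplit_insertMax`). So
admissible letters and labels of splitting sites obey one recursion (`IsCAsc.fAS_spec`), and
bijectivity follows by induction on length. -/

/-! ### The two patterns as explicit subsequences -/

theorem containsPattern_101_iff {w : List ℕ} :
    ContainsPattern w [1, 0, 1] ↔ ∃ x y, y < x ∧ [x, y, x].Sublist w := by
  constructor
  · rintro ⟨s, hs, hl, ho⟩
    obtain ⟨x, y, z, rfl⟩ := List.length_eq_three.1 hl
    have h1 := ho 1 0 (by simp) (by simp) (by simp) (by simp)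
    have h2 := ho 0 2 (by simp) (by simp) (by simp) (by simp)
    have h3 := ho 2 0 (by simp) (by simp) (by simp) (by simp)
    simp at h1 h2 h3
    obtain rfl : x = z := by omega
    exact ⟨x, y, h1, hs⟩
  · rintro ⟨x, y, h, hs⟩
    refine ⟨_, hs, rfl, fun i j hi hj _ _ => ?_⟩
    simp only [List.length_cons, List.length_nil] at hi hj
    interval_cases i <;> interval_cases j <;> simp <;> omega

theorem containsPattern_231_iff {w : List ℕ} :
    ContainsPattern w [2, 3, 1] ↔ ∃ x y z, z < x ∧ x < y ∧ [x, y, z].Sublist w := by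
  constructor
  · rintro ⟨s, hs, hl, ho⟩
    obtain ⟨x, y, z, rfl⟩ := List.length_eq_three.1 hl
    have h1 := ho 2 0 (by simp) (by simp) (by simp) (by simp)
    have h2 := ho 0 1 (by simp) (by simp) (by simp) (by simp)
    simp at h1 h2
    exact ⟨x, y, z, h1, h2, hs⟩
  · rintro ⟨x, y, z, h, h', hs⟩
    refine ⟨_, hs, rfl, fun i j hi hj _ _ => ?_⟩
    simp only [List.length_cons, List.length_nil] at hi hj
    interval_cases i <;> interval_cases j <;> simp <;> omega

/-! ### Appending a letter to a 101-avoiding ascent sequence -/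

/-- The ascent sequences that avoid `101`, of any length. -/
def IsCAsc (a : List ℕ) : Prop :=
  IsAscentSeq a ∧ ¬ ContainsPattern a [1, 0, 1]

/-- Some occurrence of `c` in `a` is followed by a smaller entry. -/
def HasDrop (a : List ℕ) (c : ℕ) : Prop :=
  ∃ d < c, [c, d].Sublist a

theorem sublist_concat_iff {α : Type*} {s a : List α} {b : α} :
    s.Sublist (a ++ [b]) ↔ s.Sublist a ∨ ∃ t, s = t ++ [b] ∧ t.Sublist a := by
  constructor
  · intro h
    obtain ⟨l₁, l₂, rfl, h₁, h₂⟩ := List.sublist_append_iff.1 h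
    rcases List.sublist_singleton.1 h₂ with rfl | rfl
    · left; simpa using h₁
    · exact Or.inr ⟨l₁, rfl, h₁⟩
  · rintro (h | ⟨t, rfl, h⟩)
    · exact h.trans (List.sublist_append_left _ _)
    · exact h.append (List.Sublist.refl _)

theorem hasDrop_concat {a : List ℕ} {b c : ℕ} :
    HasDrop (a ++ [b]) c ↔ HasDrop a c ∨ (b < c ∧ c ∈ a) := by
  unfold HasDrop
  constructor
  · rintro ⟨d, hd, h⟩
    rcases sublist_concat_iff.1 h with h | ⟨t, ht, hs⟩
    · exact Or.inl ⟨d, hd, h⟩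
    · obtain ⟨rfl, h'⟩ := List.append_inj' (s₁ := [c]) (t₁ := [d]) ht rfl
      obtain rfl : d = b := by simpa using h'
      exact Or.inr ⟨hd, List.singleton_sublist.1 hs⟩
  · rintro (⟨d, hd, h⟩ | ⟨h, hc⟩)
    · exact ⟨d, hd, sublist_concat_iff.2 (Or.inl h)⟩
    · exact ⟨b, h, sublist_concat_iff.2 (Or.inr ⟨[c], rfl, List.singleton_sublist.2 hc⟩)⟩

/-- A new occurrence uses the appended letter as its final 1, so its first two entries form a drop
from `c` inside `a`: `HasDrop` marks the letters that avoidance forbids next. -/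
theorem containsPattern_101_concat {a : List ℕ} {c : ℕ} :
    ContainsPattern (a ++ [c]) [1, 0, 1] ↔ ContainsPattern a [1, 0, 1] ∨ HasDrop a c := by
  simp only [containsPattern_101_iff, HasDrop]
  constructor
  · rintro ⟨x, y, hd, h⟩
    rcases sublist_concat_iff.1 h with h | ⟨t, ht, hs⟩
    · exact Or.inl ⟨x, y, hd, h⟩
    · obtain ⟨rfl, h'⟩ := List.append_inj' (s₁ := [x, y]) (t₁ := [x]) ht rfl
      obtain rfl : x = c := by simpa using h'
      exact Or.inr ⟨y, hd, hs⟩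
  · rintro (⟨x, y, hd, h⟩ | ⟨d, hd, h⟩)
    · exact ⟨x, y, hd, sublist_concat_iff.2 (Or.inl h)⟩
    · exact ⟨c, d, hd, sublist_concat_iff.2 (Or.inr ⟨[c, d], rfl, h⟩)⟩

theorem asc_concat_concat (a : List ℕ) (x b : ℕ) :
    asc (a ++ [x] ++ [b]) = asc (a ++ [x]) + if x < b then 1 else 0 := by
  unfold asc
  have h : (a ++ [x] ++ [b]).length - 1 = a.length + 1 := by simp
  have h' : (a ++ [x]).length - 1 = a.length := by simp
  rw [h, h', Finset.range_add_one, Finset.filter_insert]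
  have e : ∀ i ∈ Finset.range a.length,
      ((a ++ [x] ++ [b]).getD i 0 < (a ++ [x] ++ [b]).getD (i + 1) 0 ↔
        (a ++ [x]).getD i 0 < (a ++ [x]).getD (i + 1) 0) := by
    intro i hi
    have hi := Finset.mem_range.1 hi
    rw [List.getD_append (a ++ [x]) [b] 0 i (by simp; omega),
      List.getD_append (a ++ [x]) [b] 0 (i + 1) (by simp; omega)]
  rw [Finset.filter_congr e]
  have e1 : (a ++ [x] ++ [b]).getD a.length 0 = x := by simp
  have e2 : (a ++ [x] ++ [b]).getD (a.length + 1) 0 = b := by simp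
  rw [e1, e2]
  split_ifs
  · rw [Finset.card_insert_of_notMem (by simp)]
  · simp

theorem isAscentSeq_concat {a : List ℕ} {b : ℕ} :
    IsAscentSeq (a ++ [b]) ↔
      IsAscentSeq a ∧ (a = [] → b = 0) ∧ (a ≠ [] → b ≤ asc a + 1) := by
  unfold IsAscentSeq
  constructor
  · rintro ⟨h0, h⟩
    refine ⟨⟨fun ha => ?_, fun i hi hi0 => ?_⟩, ?_, fun ha => ?_⟩
    · have := h0 (by simp)
      rwa [List.getElem_append_left ha] at this
    · have := h i (by simp; omega) hi0
      rwa [List.getElem_append_left hi, List.take_append_of_le_length hi.le] at this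
    · rintro rfl
      simpa using h0
    · have := h a.length (by simp) (List.length_pos_iff.2 ha)
      simpa using this
  · rintro ⟨⟨h0, h⟩, h1, h2⟩
    constructor
    · intro _
      by_cases ha : a = []
      · subst ha; simpa using h1 rfl
      · rw [List.getElem_append_left (List.length_pos_iff.2 ha)]
        exact h0 _
    · intro i hi hi0
      rcases Nat.lt_or_ge i a.length with hl | hl
      · rw [List.getElem_append_left hl, List.take_append_of_le_length hl.le]
        exact h i hl hi0
      · obtain rfl : i = a.length := by simp at hi; omega
        simpa using h2 (List.length_pos_iff.1 hi0)

theorem isCAsc_concat {a : List ℕ} {b : ℕ} :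
    IsCAsc (a ++ [b]) ↔
      IsCAsc a ∧ (a = [] → b = 0) ∧ (a ≠ [] → b ≤ asc a + 1) ∧ ¬ HasDrop a b := by
  unfold IsCAsc
  rw [isAscentSeq_concat, containsPattern_101_concat]
  tauto

theorem IsCAsc.nil : IsCAsc [] := by
  refine ⟨⟨by simp, by simp⟩, ?_⟩
  rw [containsPattern_101_iff]
  simp

theorem IsCAsc.take {a : List ℕ} (h : IsCAsc a) (k : ℕ) : IsCAsc (a.take k) := by
  induction a using List.reverseRecOn with
  | nil => simpa using h
  | append_singleton a b ih =>
    rcases Nat.lt_or_ge a.length k with hk | hk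
    · rwa [List.take_of_length_le (by simp; omega)]
    · rw [List.take_append_of_le_length hk]
      exact ih (isCAsc_concat.1 h).1

/-- If `b` exceeds the last letter `x` but `b ≤ asc a`, then `b` already occurs before `x`, which is
a drop. So only a new letter makes an ascent. The description of the letters is a hypothesis because
`IsCAsc.mem_iff` uses this lemma in its own induction. -/
theorem asc_concat_of_mem_iff {a : List ℕ} {b : ℕ} (ha : a ≠ [])
    (hm : ∀ x, x ∈ a ↔ x ≤ asc a) (hb : b ≤ asc a + 1) (hd : ¬ HasDrop a b) :
    asc (a ++ [b]) = if b = asc a + 1 then asc a + 1 else asc a := by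
  obtain ⟨c, x, rfl⟩ : ∃ c x, a = c ++ [x] := by
    exact ⟨_, _, (List.dropLast_append_getLast ha).symm⟩
  rw [asc_concat_concat]
  have hx := (hm x).1 (by simp)
  rw [hasDrop_concat] at hd
  have hb' := hm b
  simp only [List.mem_append, List.mem_singleton] at hb'
  split_ifs with h1 h2 h2
  · rfl
  · exact absurd (hb'.2 (by omega)) (by rintro (h | h); exacts [hd (Or.inr ⟨h1, h⟩), by omega])
  · omega
  · rfl

theorem IsCAsc.mem_iff {a : List ℕ} (h : IsCAsc a) (ha : a ≠ []) (x : ℕ) :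
    x ∈ a ↔ x ≤ asc a := by
  induction a using List.reverseRecOn generalizing x with
  | nil => exact absurd rfl ha
  | append_singleton a b ih =>
    obtain ⟨h1, h2, h3, h4⟩ := isCAsc_concat.1 h
    by_cases hn : a = []
    · subst hn
      simp [h2 rfl, asc]
    · rw [asc_concat_of_mem_iff hn (ih h1 hn) (h3 hn) h4]
      have := h3 hn
      simp only [List.mem_append, List.mem_singleton, ih h1 hn]
      split_ifs <;> omega

theorem IsCAsc.asc_concat {a : List ℕ} {b : ℕ} (h : IsCAsc (a ++ [b])) (ha : a ≠ []) :
    asc (a ++ [b]) = if b = asc a + 1 then asc a + 1 else asc a := by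
  obtain ⟨h1, -, h3, h4⟩ := isCAsc_concat.1 h
  exact asc_concat_of_mem_iff ha (h1.mem_iff ha) (h3 ha) h4

theorem IsCAsc.not_hasDrop {a : List ℕ} {c : ℕ} (h : c ∉ a) : ¬ HasDrop a c := by
  rintro ⟨d, -, hd⟩
  exact h (hd.subset (by simp))

/-- The letters extending `a ++ [b]` are those at most `b` that extend `a`, and the largest
letter allowed in an ascent sequence. -/
theorem IsCAsc.concat_concat_iff {a : List ℕ} {b c : ℕ} (h : IsCAsc (a ++ [b])) (ha : a ≠ []) :
    IsCAsc (a ++ [b] ++ [c]) ↔ (IsCAsc (a ++ [c]) ∧ c ≤ b) ∨ c = asc (a ++ [b]) + 1 := by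
  obtain ⟨h1, -, h3, h4⟩ := isCAsc_concat.1 h
  have hab : a ++ [b] ≠ [] := by simp
  have hm := h.mem_iff hab c
  have hm' := h1.mem_iff ha c
  have hs := h.asc_concat ha
  have h3 := h3 ha
  have hn : c ∉ a ++ [b] → ¬ HasDrop (a ++ [b]) c := IsCAsc.not_hasDrop
  rw [isCAsc_concat, isCAsc_concat (b := c)]
  simp only [h, h1, ha, hab, true_and, false_imp_iff, not_false_iff, ne_eq, true_imp_iff]
  rw [hasDrop_concat] at hn ⊢
  rw [hs] at hm ⊢
  simp only [List.mem_append, List.mem_singleton] at hm hn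
  constructor
  · rintro ⟨h5, h6⟩
    rw [not_or] at h6
    by_cases hc : c ≤ b
    · exact Or.inl ⟨⟨by omega, h6.1⟩, hc⟩
    · right
      by_contra hne
      -- A non-maximal `c > b` would already occur in `a`, and the final `b` would complete a drop
      -- from it.
      exact h6.2 ⟨by omega, (hm.2 (by omega)).resolve_right (by omega)⟩
  · rintro (⟨⟨h5, h6⟩, hc⟩ | hc)
    · refine ⟨by split_ifs <;> omega, ?_⟩
      rintro (h7 | h7)
      exacts [h6 h7, by omega]
    · exact ⟨hc.le, hn (by rw [hm]; omega)⟩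

/-! ### Inserting the maximum into a 231-avoiding permutation -/

theorem insertIdx_eq_take_append_cons_drop {α : Type*} {l : List α} {i : ℕ} (x : α)
    (h : i ≤ l.length) : l.insertIdx i x = l.take i ++ x :: l.drop i := by
  induction l generalizing i with
  | nil => obtain rfl : i = 0 := by simpa using h
           simp
  | cons a l ih =>
    cases i with
    | zero => simp
    | succ i => simpa using ih (by simpa using h)

theorem length_of_mem_perms {n : ℕ} {w : List ℕ} (h : w ∈ Perms n) : w.length = n := by
  simpa using List.Perm.length_eq h

theorem mem_iff_of_mem_perms {n : ℕ} {w : List ℕ} (h : w ∈ Perms n) (x : ℕ) :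
    x ∈ w ↔ 1 ≤ x ∧ x ≤ n := by
  rw [List.Perm.mem_iff h, List.mem_range'_1]
  omega

theorem nodup_of_mem_perms {n : ℕ} {w : List ℕ} (h : w ∈ Perms n) : w.Nodup :=
  (List.Perm.nodup_iff h).2 List.nodup_range'

theorem insertIdx_mem_perms_iff {n i : ℕ} {w : List ℕ} (hi : i ≤ w.length) :
    w.insertIdx i (n + 1) ∈ Perms (n + 1) ↔ w ∈ Perms n := by
  have h : (List.range' 1 (n + 1)).Perm ((n + 1) :: List.range' 1 n) := by
    rw [List.range'_1_concat, Nat.add_comm 1 n]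
    exact List.perm_append_singleton _ _
  have h' := List.perm_insertIdx (n + 1) w hi
  constructor
  · intro hw
    exact (List.perm_cons _).1 (h'.symm.trans (List.Perm.trans hw h))
  · intro hw
    exact (h'.trans (List.Perm.cons _ hw)).trans h.symm

/-- Site `i` splits `w` into a left part all of whose entries are smaller than those on the
right. -/
def IsSplit (w : List ℕ) (i : ℕ) : Prop :=
  i ≤ w.length ∧ ∀ x ∈ w.take i, ∀ y ∈ w.drop i, x < y

theorem sublist_append_of_sublist_append_cons {s u v : List ℕ} {M : ℕ}
    (h : s.Sublist (u ++ M :: v)) (hs : M ∉ s) (hu : M ∉ u) : s.Sublist (u ++ v) := by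
  have := h.erase M
  rwa [List.erase_of_not_mem hs, List.erase_append_right _ hu, List.erase_cons_head] at this

/-- The maximum can only play the 3, so a new occurrence is an inversion across the insertion point.
-/
theorem containsPattern_231_insert {u v : List ℕ} {M : ℕ} (hu : ∀ x ∈ u, x < M)
    (hv : ∀ x ∈ v, x < M) :
    ContainsPattern (u ++ M :: v) [2, 3, 1] ↔
      ContainsPattern (u ++ v) [2, 3, 1] ∨ ∃ x ∈ u, ∃ z ∈ v, z < x := by
  simp only [containsPattern_231_iff]
  have huM : M ∉ u := fun h => (hu M h).false
  have hvM : M ∉ v := fun h => (hv M h).false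
  constructor
  · rintro ⟨x, y, z, hzx, hxy, hs⟩
    have hle : ∀ t ∈ [x, y, z], t ≤ M := by
      intro t ht
      have := hs.subset ht
      simp only [List.mem_append, List.mem_cons] at this
      rcases this with h | h | h
      exacts [(hu t h).le, h.le, (hv t h).le]
    by_cases hM : M ∈ [x, y, z]
    · right
      have hyM := hle y (by simp)
      obtain rfl : y = M := by
        simp only [List.mem_cons, List.not_mem_nil, or_false] at hM
        omega
      obtain ⟨l₁, l₂, he, h₁, h₂⟩ := List.sublist_append_iff.1 hs
      -- `l₁` is the part of `[x, M, z]` lying in `u`. It must be `[x]`: otherwise `M` would lie in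
      -- `u` or in `v`, or `x` would equal `M`.
      match l₁, he with
      | [], he =>
        simp only [List.nil_append] at he
        subst he
        rcases List.sublist_cons_iff.1 h₂ with h | ⟨r, hr, h⟩
        · exact absurd (h.subset (by simp)) hvM
        · simp only [List.cons.injEq] at hr
          omega
      | [a], he =>
        simp only [List.cons_append, List.nil_append, List.cons.injEq] at he
        obtain ⟨rfl, rfl⟩ := he
        refine ⟨x, h₁.subset (by simp), z, ?_, hzx⟩
        have := h₂.subset (show z ∈ [y, z] by simp)
        exact (List.mem_cons.1 this).resolve_left (by omega)
      | a :: b :: l, he =>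
        simp only [List.cons_append, List.cons.injEq] at he
        obtain ⟨rfl, rfl, -⟩ := he
        exact absurd (h₁.subset (by simp)) huM
    · exact Or.inl ⟨x, y, z, hzx, hxy, sublist_append_of_sublist_append_cons hs hM huM⟩
  · rintro (⟨x, y, z, hzx, hxy, hs⟩ | ⟨x, hx, z, hz, hzx⟩)
    · exact ⟨x, y, z, hzx, hxy,
        hs.trans ((List.Sublist.refl u).append (List.sublist_cons_self M v))⟩
    · exact ⟨x, M, z, hzx, hu x hx, (List.singleton_sublist.2 hx).append
        ((List.singleton_sublist.2 hz).cons_cons M)⟩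

theorem insertIdx_mem_cPerms_iff {n i : ℕ} {w : List ℕ} (hi : i ≤ w.length) :
    w.insertIdx i (n + 1) ∈ CPerms (n + 1) ↔ w ∈ CPerms n ∧ IsSplit w i := by
  unfold CPerms IsSplit
  simp only [Set.mem_ofPred_eq]
  rw [insertIdx_mem_perms_iff hi]
  by_cases hw : w ∈ Perms n
  swap
  · simp [hw]
  have hlt : ∀ x ∈ w, x < n + 1 := fun x hx => by
    have := (mem_iff_of_mem_perms hw x).1 hx
    omega
  rw [insertIdx_eq_take_append_cons_drop _ hi, containsPattern_231_insert
    (fun x hx => hlt x (List.mem_of_mem_take hx)) (fun x hx => hlt x (List.mem_of_mem_drop hx)),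
    List.take_append_drop]
  have hd : ∀ x ∈ w.take i, ∀ y ∈ w.drop i, x ≠ y := by
    have := nodup_of_mem_perms hw
    rw [← List.take_append_drop i w, List.nodup_append] at this
    exact this.2.2
  simp only [hw, hi, true_and, not_or, not_exists, not_and, not_lt]
  refine and_congr_right fun _ => ⟨fun h x hx y hy => lt_of_le_of_ne (h x hx y hy) (hd x hx y hy),
    fun h x hx y hy => (h x hx y hy).le⟩

theorem exists_eq_insertIdx_of_mem_perms {n : ℕ} {w' : List ℕ} (h : w' ∈ Perms (n + 1)) :
    ∃ (w : List ℕ) (i : ℕ), i ≤ w.length ∧ w' = w.insertIdx i (n + 1) := by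
  obtain ⟨u, v, rfl⟩ := List.append_of_mem ((mem_iff_of_mem_perms h (n + 1)).2 (by omega))
  refine ⟨u ++ v, u.length, by simp, ?_⟩
  rw [insertIdx_eq_take_append_cons_drop _ (by simp)]
  simp

/-- The predecessor of the entry before the site cannot lie to the right, where all entries are
larger. -/
theorem IsSplit.entry {n i : ℕ} {w : List ℕ} (hw : w ∈ Perms n) (h : IsSplit w i) (hi : i ≠ 0) :
    w.getD (i - 1) 0 = 1 ∨ w.getD (i - 1) 0 - 1 ∈ w.take (i - 1) := by
  obtain ⟨k, rfl⟩ := Nat.exists_eq_succ_of_ne_zero hi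
  obtain ⟨hl, hs⟩ := h
  have hk : k < w.length := hl
  simp only [Nat.succ_eq_add_one, Nat.add_sub_cancel, List.getD_eq_getElem _ _ hk] at hs ⊢
  rw [List.take_succ_eq_append_getElem hk] at hs
  have hm := (mem_iff_of_mem_perms hw w[k]).1 (List.getElem_mem hk)
  by_contra! hc
  have hp : w[k] - 1 ∈ w.take (k + 1) ++ w.drop (k + 1) := by
    rw [List.take_append_drop, mem_iff_of_mem_perms hw]
    omega
  rw [List.take_succ_eq_append_getElem hk] at hp
  simp only [List.mem_append, List.mem_singleton, hc.2, false_or] at hp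
  rcases hp with hp | hp
  · omega
  · have := hs w[k] (List.mem_append_right _ (List.mem_singleton_self _)) _ hp
    omega

theorem IsSplit.isActive {n i : ℕ} {w : List ℕ} (hw : w ∈ Perms n) (h : IsSplit w i) :
    IsActive w i := by
  by_cases hi : i = 0
  · exact Or.inl hi
  · exact Or.inr (Or.inr (h.entry hw hi))

theorem isSplit_length (w : List ℕ) : IsSplit w w.length :=
  ⟨le_rfl, by simp⟩

/-! ### Active and splitting sites after an insertion -/

theorem isActive_insert_left {u v : List ℕ} {M j : ℕ} (hj : j ≤ u.length)
    (hne : j ≠ (u ++ v).length) : IsActive (u ++ M :: v) j ↔ IsActive (u ++ v) j := by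
  unfold IsActive
  rcases Nat.eq_zero_or_pos j with rfl | hj0
  · simp
  have h1 : j ≠ (u ++ M :: v).length := by simp at hne ⊢; omega
  simp only [h1, hne, false_or]
  rw [List.getD_append _ _ _ _ (by omega), List.getD_append _ _ _ _ (by omega),
    List.take_append_of_le_length (by omega), List.take_append_of_le_length (by omega)]

theorem isActive_insert_middle {u v : List ℕ} {M : ℕ} :
    IsActive (u ++ M :: v) (u.length + 1) ↔ v = [] ∨ M = 1 ∨ M - 1 ∈ u := by
  unfold IsActive
  simp [eq_comm]

theorem isActive_insert_right {u v : List ℕ} {M k : ℕ} (hk : k < v.length)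
    (hv : ∀ x ∈ v, x ≤ M) (hM : 0 < M) :
    IsActive (u ++ M :: v) (u.length + k + 2) ↔ IsActive (u ++ v) (u.length + k + 1) := by
  unfold IsActive
  have h1 : u.length + k + 2 = (u ++ M :: v).length ↔
      u.length + k + 1 = (u ++ v).length := by simp; omega
  rw [h1]
  have h2 : (u ++ M :: v).getD (u.length + k + 2 - 1) 0 = v[k] := by
    rw [List.getD_append_right _ _ _ _ (by omega),
      show u.length + k + 2 - 1 - u.length = k + 1 by omega]
    simp [hk]
  have h3 : (u ++ v).getD (u.length + k + 1 - 1) 0 = v[k] := by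
    rw [List.getD_append_right _ _ _ _ (by omega),
      show u.length + k + 1 - 1 - u.length = k by omega]
    simp [hk]
  have h4 : (u ++ M :: v).take (u.length + k + 2 - 1) = u ++ M :: v.take k := by
    rw [show u.length + k + 2 - 1 = u.length + (k + 1) by omega, List.take_length_add_append]
    simp
  have h5 : (u ++ v).take (u.length + k + 1 - 1) = u ++ v.take k := by
    rw [show u.length + k + 1 - 1 = u.length + k by omega, List.take_length_add_append]
  rw [h2, h3, h4, h5]
  -- The inserted `M` is nobody's predecessor in `v`; `0 < M` rules out the truncated case `v[k] =
  -- 0`.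
  have h6 : v[k] - 1 ≠ M := by
    have := hv _ (List.getElem_mem hk)
    omega
  simp [h6]

/-- To the right of `M` a site splits only if nothing follows it; up to `M`, the extra large entry
on the right is harmless. -/
theorem isSplit_insert {u v : List ℕ} {M j : ℕ} (hu : ∀ x ∈ u, x < M) (hv : ∀ x ∈ v, x < M) :
    IsSplit (u ++ M :: v) j ↔
      (j ≤ u.length ∧ IsSplit (u ++ v) j) ∨ j = (u ++ v).length + 1 := by
  unfold IsSplit
  simp only [List.length_append, List.length_cons]
  rcases Nat.lt_or_ge u.length j with hj | hj
  · have hj' : ¬ j ≤ u.length := by omega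
    simp only [hj', false_and, false_or]
    obtain ⟨k, rfl⟩ := Nat.exists_eq_add_of_lt hj
    rw [Nat.add_assoc, List.take_length_add_append, List.drop_length_add_append]
    simp only [List.take_succ_cons, List.drop_succ_cons]
    constructor
    · rintro ⟨h1, h2⟩
      by_contra hne
      have hk : k < v.length := by omega
      have hm : v[k] ∈ v.drop k := by
        exact List.mem_drop_iff_getElem.2 ⟨0, by simpa using hk, by simp⟩
      have := h2 M (by simp) _ hm
      have := hv _ (List.getElem_mem hk)
      omega
    · intro h
      have hk : k = v.length := by omega
      subst hk
      exact ⟨by omega, by simp⟩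
  · have h1 : j ≠ u.length + v.length + 1 := by omega
    have h2 : j ≤ u.length + v.length := by omega
    have h3 : j ≤ u.length + (v.length + 1) := by omega
    simp only [hj, h1, h2, h3, true_and, or_false]
    rw [List.take_append_of_le_length hj, List.take_append_of_le_length hj,
      List.drop_append_of_le_length hj, List.drop_append_of_le_length hj]
    refine forall₂_congr fun x hx => ⟨fun h y hy => h y ?_, fun h y hy => ?_⟩
    · simp only [List.mem_append, List.mem_cons] at hy ⊢
      tauto
    · simp only [List.mem_append, List.mem_cons] at hy
      rcases hy with hy | rfl | hy
      · exact h y (by simp [hy])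
      · exact hu x (List.mem_of_mem_take hx)
      · exact h y (by simp [hy])

theorem mem_activeSites {w : List ℕ} {j : ℕ} :
    j ∈ activeSites w ↔ j ≤ w.length ∧ IsActive w j := by
  simp [activeSites]

theorem pairwise_activeSites (w : List ℕ) : (activeSites w).Pairwise (· < ·) :=
  List.pairwise_lt_range.filter _

theorem activeSites_getElem_lt_iff {w : List ℕ} {b c : ℕ} (hb : b < (activeSites w).length)
    (hc : c < (activeSites w).length) : (activeSites w)[b] < (activeSites w)[c] ↔ b < c :=
  (pairwise_activeSites w).sortedLT.strictMono_get.lt_iff_lt (a := ⟨b, hb⟩) (b := ⟨c, hc⟩)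

theorem activeSites_insertIdx_length {n : ℕ} {w : List ℕ} (hw : w ∈ Perms n) :
    activeSites (w.insertIdx n (n + 1)) = activeSites w ++ [n + 1] := by
  have hl := length_of_mem_perms hw
  refine (pairwise_activeSites _).eq_of_mem_iff (List.pairwise_append.2
    ⟨pairwise_activeSites w, List.pairwise_singleton _ _, fun x hx y hy => ?_⟩) fun j => ?_
  · have := (mem_activeSites.1 hx).1
    simp only [List.mem_singleton] at hy
    omega
  · rw [insertIdx_eq_take_append_cons_drop _ hl.ge, List.mem_append, mem_activeSites,
      mem_activeSites, ← hl]
    simp only [List.take_length, List.drop_length, List.length_append, List.length_singleton,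
      List.mem_singleton]
    rcases Nat.lt_trichotomy j w.length with h | rfl | h
    · have := isActive_insert_left (u := w) (v := []) (M := w.length + 1) h.le (by simp; omega)
      have h1 : j ≤ w.length + 1 := by omega
      have h2 : j ≠ w.length + 1 := by omega
      rw [this, List.append_nil]
      simp only [h.le, h1, h2, true_and, or_false]
    · have h1 : IsActive w w.length := (isSplit_length w).isActive hw
      -- The old end is no longer the last site, so its activity must now come from the entry before
      -- it.
      have h2 : IsActive (w ++ [w.length + 1]) w.length := by
        rcases Nat.eq_zero_or_pos w.length with h | h
        · exact Or.inl h
        · have := (isSplit_length w).entry hw h.ne'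
          refine Or.inr (Or.inr ?_)
          rwa [List.getD_append _ _ _ _ (by omega), List.take_append_of_le_length (by omega)]
      simp [h1, h2]
    · have h1 : ¬ j ≤ w.length := by omega
      simp only [h1, false_and, false_or]
      constructor
      · rintro ⟨h2, -⟩
        omega
      · rintro rfl
        exact ⟨le_rfl, Or.inr (Or.inl (by simp))⟩

/-- The site just after `n + 1` is inactive: since the right part is nonempty and has the larger
entries, `n` lies there. The other sites keep their status and are at most shifted. -/
theorem activeSites_insertIdx_of_lt {n i : ℕ} {w : List ℕ} (hw : w ∈ Perms n) (hi : i < n)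
    (hs : IsSplit w i) :
    activeSites (w.insertIdx i (n + 1)) =
      (activeSites w).map (fun j => if j ≤ i then j else j + 1) := by
  have hl := length_of_mem_perms hw
  have hlt : ∀ x ∈ w, x < n + 1 := fun x hx => by
    have := (mem_iff_of_mem_perms hw x).1 hx
    omega
  refine (pairwise_activeSites _).eq_of_mem_iff
    ((pairwise_activeSites w).map _ fun a b hab => ?_) fun j => ?_
  · split_ifs <;> omega
  · rw [insertIdx_eq_take_append_cons_drop _ (by omega)]
    have hul : (w.take i).length = i := by simp; omega
    have hvl : (w.drop i).length = n - i := by simp [hl]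
    have huv := List.take_append_drop i w
    have hleft := @isActive_insert_left (w.take i) (w.drop i) (n + 1)
    have hmid := @isActive_insert_middle (w.take i) (w.drop i) (n + 1)
    have hright := @isActive_insert_right (w.take i) (w.drop i) (n + 1)
    rw [huv] at hleft hright
    rw [hul] at hleft hmid hright
    simp only [mem_activeSites, List.mem_map, List.length_append, List.length_cons, hul, hvl]
    rcases Nat.lt_trichotomy j (i + 1) with h | rfl | h
    · rw [hleft (by omega) (by omega)]
      constructor
      · rintro ⟨-, h2⟩
        exact ⟨j, ⟨by omega, h2⟩, if_pos (by omega)⟩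
      · rintro ⟨k, ⟨-, h2⟩, h3⟩
        split_ifs at h3 with hk
        · subst h3
          exact ⟨by omega, h2⟩
        · omega
    · rw [hmid]
      constructor
      · rintro ⟨-, h | h | h⟩
        · rw [h] at hvl
          simp at hvl
          omega
        · omega
        · have hv0 : 0 < (w.drop i).length := by omega
          have h1 := hs.2 _ h _ (List.getElem_mem hv0)
          have h2 := hlt _ (List.mem_of_mem_drop (List.getElem_mem hv0))
          omega
      · rintro ⟨k, -, h3⟩
        split_ifs at h3 <;> omega
    · obtain ⟨k, rfl⟩ : ∃ k, j = i + k + 2 := ⟨j - i - 2, by omega⟩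
      constructor
      · rintro ⟨h1, h2⟩
        rw [hright (by omega) (fun x hx => (hlt x (List.mem_of_mem_drop hx)).le) (by omega)] at h2
        exact ⟨i + k + 1, ⟨by omega, h2⟩, by rw [if_neg (by omega)]⟩
      · rintro ⟨m, ⟨h1, h2⟩, h3⟩
        split_ifs at h3
        · omega
        · obtain rfl : m = i + k + 1 := by omega
          refine ⟨by omega, ?_⟩
          rwa [hright (by omega) (fun x hx => (hlt x (List.mem_of_mem_drop hx)).le) (by omega)]

/-! ### Matching admissible letters with labels of splitting sites -/

/-- The largest letter that may extend the ascent sequence `a`. -/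
def maxLetter (a : List ℕ) : ℕ :=
  if a = [] then 0 else asc a + 1

theorem IsCAsc.maxLetter_concat {a : List ℕ} {b : ℕ} (h : IsCAsc (a ++ [b])) :
    maxLetter (a ++ [b]) = if b = maxLetter a then maxLetter a + 1 else maxLetter a := by
  by_cases ha : a = []
  · subst ha
    obtain rfl := (isCAsc_concat.1 h).2.1 rfl
    simp [maxLetter, asc]
  · simp only [maxLetter, ha, if_false, h.asc_concat ha, List.append_eq_nil_iff, false_and]
    split_ifs <;> rfl

theorem IsCAsc.concat_concat_iff_maxLetter {a : List ℕ} {b c : ℕ} (h : IsCAsc (a ++ [b])) :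
    IsCAsc (a ++ [b] ++ [c]) ↔ (IsCAsc (a ++ [c]) ∧ c ≤ b) ∨ c = maxLetter (a ++ [b]) := by
  by_cases ha : a = []
  · subst ha
    obtain rfl := (isCAsc_concat.1 h).2.1 rfl
    rw [isCAsc_concat, isCAsc_concat (b := c)]
    have h1 : ¬ HasDrop [] c := IsCAsc.not_hasDrop (by simp)
    have h2 : ¬ HasDrop ([] ++ [0]) c := by
      rw [hasDrop_concat]
      simpa using h1
    have h3 : asc ([] ++ [0]) = 0 := by simp [asc]
    simp only [h, h2, h3, h1, IsCAsc.nil, maxLetter]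
    simp
    omega
  · rw [h.concat_concat_iff ha]
    simp [maxLetter]

theorem fAS_concat (a : List ℕ) (b : ℕ) : fAS (a ++ [b]) = insertMax (fAS a) b := by
  simp [fAS]

theorem insertMax_eq {n b : ℕ} {w : List ℕ} (hw : w ∈ Perms n) (hb : b < (activeSites w).length) :
    insertMax w b = w.insertIdx (activeSites w)[b] (n + 1) := by
  rw [insertMax, List.getD_eq_getElem _ _ hb, length_of_mem_perms hw]

theorem isSplit_insertIdx {n i j : ℕ} {w : List ℕ} (hw : w ∈ Perms n) (hi : i ≤ n) :
    IsSplit (w.insertIdx i (n + 1)) j ↔ (j ≤ i ∧ IsSplit w j) ∨ j = n + 1 := by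
  have hl := length_of_mem_perms hw
  have hlt : ∀ x ∈ w, x < n + 1 := fun x hx => by
    have := (mem_iff_of_mem_perms hw x).1 hx
    omega
  rw [insertIdx_eq_take_append_cons_drop _ (by omega),
    isSplit_insert (fun x hx => hlt x (List.mem_of_mem_take hx))
      (fun x hx => hlt x (List.mem_of_mem_drop hx)), List.take_append_drop, hl,
    List.length_take_of_le (by omega)]

/-- The last active site is the end of the permutation. -/
theorem activeSites_getElem_eq_iff {n m c : ℕ} {w : List ℕ} (hw : w ∈ Perms n)
    (hm : (activeSites w).length = m + 1) (hc : c < (activeSites w).length) :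
    (activeSites w)[c] = n ↔ c = m := by
  have hn : n ∈ activeSites w := by
    rw [mem_activeSites, length_of_mem_perms hw]
    exact ⟨le_rfl, Or.inr (Or.inl (length_of_mem_perms hw).symm)⟩
  have hle : ∀ j ∈ activeSites w, j ≤ n := fun j hj => by
    have := (mem_activeSites.1 hj).1
    rwa [length_of_mem_perms hw] at this
  obtain ⟨d, hd, hdn⟩ := List.getElem_of_mem hn
  obtain rfl : d = m := by
    by_contra hne
    have h1 : m < (activeSites w).length := by omega
    have h2 := (activeSites_getElem_lt_iff hd h1).2 (by omega)
    have := hle _ (List.getElem_mem h1)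
    omega
  rw [← hdn, (pairwise_activeSites w).sortedLT.nodup.getElem_inj_iff]

/-- Inserting the maximum at the active site labelled `b`, when this site splits the permutation,
keeps the number of active sites unless `b` is the last label, in which case there is one more;
the labels of splitting sites are then the old ones up to `b`, and the last one. -/
theorem isSplit_insertMax {n m b : ℕ} {w : List ℕ} (hw : w ∈ Perms n)
    (hm : (activeSites w).length = m + 1) (hb : b < (activeSites w).length)
    (hs : IsSplit w (activeSites w)[b]) :
    (activeSites (insertMax w b)).length = (if b = m then m + 1 else m) + 1 ∧
    ∀ c, (∃ hc : c < (activeSites (insertMax w b)).length,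
        IsSplit (insertMax w b) (activeSites (insertMax w b))[c]) ↔
      ((∃ hc : c < (activeSites w).length, IsSplit w (activeSites w)[c]) ∧ c ≤ b) ∨
        c = if b = m then m + 1 else m := by
  have hl := length_of_mem_perms hw
  have hlast := activeSites_getElem_eq_iff hw hm hb
  rw [insertMax_eq hw hb]
  have hin : (activeSites w)[b] ≤ n := hl ▸ hs.1
  simp only [isSplit_insertIdx hw hin]
  by_cases hbm : b = m
  · have hbn := hlast.2 hbm
    subst hbm
    have hK : activeSites (w.insertIdx (activeSites w)[b] (n + 1)) = activeSites w ++ [n + 1] := by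
      rw [hbn, activeSites_insertIdx_length hw]
    simp only [hK, ↓reduceIte, List.length_append, List.length_singleton, hm, true_and]
    intro c
    rcases Nat.lt_trichotomy c (b + 1) with hc | rfl | hc
    · have hc' : c < (activeSites w).length := by omega
      have h1 : (activeSites w)[c] ≤ n := hl ▸ (mem_activeSites.1 (List.getElem_mem hc')).1
      have h3 : (activeSites w)[c] ≠ n + 1 := by omega
      have h4 : c ≠ b + 1 := hc.ne
      simp only [List.getElem_append_left hc', hbn, h1, h3, h4, hc, true_and, or_false,
        exists_prop]
      have h5 : c < b + 1 + 1 := by omega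
      have h6 : c ≤ b := by omega
      simp only [h5, h6, and_true, true_and, exists_true_left]
    · have h5 : (activeSites w ++ [n + 1])[b + 1]'(by simp [hm]) = n + 1 := by
        rw [List.getElem_append_right (by omega)]
        simp
      simp [h5]
    · constructor
      · rintro ⟨h, -⟩
        omega
      · rintro (⟨⟨h, -⟩, -⟩ | h) <;> omega
  · have hbn : (activeSites w)[b] < n := lt_of_le_of_ne hin fun h => hbm (hlast.1 h)
    have hK := activeSites_insertIdx_of_lt hw hbn hs
    simp only [hK, hbm, if_false, List.length_map, hm, true_and]
    intro c
    rcases Nat.lt_or_ge m c with hc | hc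
    · constructor
      · rintro ⟨h, -⟩
        omega
      · rintro (⟨⟨h, -⟩, -⟩ | h) <;> omega
    · have hc' : c < (activeSites w).length := by omega
      have hcb := activeSites_getElem_lt_iff hb hc'
      have hcm := activeSites_getElem_eq_iff hw hm hc'
      have hc1 : c < m + 1 := by omega
      simp only [hc1, List.getElem_map, exists_true_left]
      rcases Nat.lt_or_ge b c with h | h
      · have h1 := hcb.2 h
        have h2 : ¬ c ≤ b := by omega
        simp only [h1.not_ge, if_false, h2, and_false, false_or]
        -- A site with label `c > b` now lies to the right of the maximum, so it splits only if it
        -- is the end.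
        rw [← hcm]
        omega
      · have h1 : (activeSites w)[c] ≤ (activeSites w)[b] := by
          by_contra h3
          exact absurd (hcb.1 (by omega)) (by omega)
        have h2 : c ≠ m := by omega
        have h3 : (activeSites w)[c] ≠ n + 1 := by omega
        simp only [h1, if_true, h, h2, h3, and_true, true_and]

/-- `fAS` translates the letters extending a `101`-avoiding ascent sequence into the labels of the
sites at which the maximum may be inserted without creating `231`. -/
theorem IsCAsc.fAS_spec {a : List ℕ} (ha : IsCAsc a) :
    fAS a ∈ CPerms a.length ∧ (activeSites (fAS a)).length = maxLetter a + 1 ∧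
      ∀ b, IsCAsc (a ++ [b]) ↔
        ∃ hb : b < (activeSites (fAS a)).length, IsSplit (fAS a) (activeSites (fAS a))[b] := by
  induction a using List.reverseRecOn with
  | nil =>
    have h : activeSites (fAS []) = [0] := by decide
    refine ⟨⟨List.Perm.refl _, ?_⟩, ?_, fun b => ?_⟩
    · rw [containsPattern_231_iff]
      simp [fAS]
    · simp [h, maxLetter]
    · have h1 : ¬ HasDrop [] b := IsCAsc.not_hasDrop (by simp)
      rw [isCAsc_concat]
      simp only [h, h1, IsCAsc.nil]
      constructor
      · intro hb
        obtain rfl : b = 0 := hb.2.1 trivial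
        exact ⟨by simp, isSplit_length []⟩
      · rintro ⟨hb, -⟩
        simp at hb
        simp [hb]
  | append_singleton a b ih =>
    obtain ⟨hw, hm, hspec⟩ := ih (isCAsc_concat.1 ha).1
    obtain ⟨hb, hs⟩ := (hspec b).1 ha
    obtain ⟨h1, h2⟩ := isSplit_insertMax hw.1 hm hb hs
    rw [fAS_concat, ha.maxLetter_concat]
    refine ⟨?_, h1, fun c => ?_⟩
    · rw [insertMax_eq hw.1 hb, List.length_append, List.length_singleton,
        insertIdx_mem_cPerms_iff hs.1]
      exact ⟨hw, hs⟩
    · rw [ha.concat_concat_iff_maxLetter, ha.maxLetter_concat, h2, hspec]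

/-! ### Bijectivity -/

/-- Erasing the maximum recovers the previous permutation, and its position recovers the label, that
is, the last letter. -/
theorem fAS_injOn (n : ℕ) : Set.InjOn fAS (CAsc n) := by
  induction n with
  | zero =>
    rintro a ⟨ha, -⟩ a' ⟨ha', -⟩ -
    rw [List.length_eq_zero_iff.1 ha, List.length_eq_zero_iff.1 ha']
  | succ n ih =>
    rintro a ⟨hl, ha⟩ a' ⟨hl', ha'⟩ he
    rcases List.eq_nil_or_concat' a with rfl | ⟨a, b, rfl⟩
    · simp at hl
    rcases List.eq_nil_or_concat' a' with rfl | ⟨a', b', rfl⟩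
    · simp at hl'
    change IsCAsc _ at ha ha'
    obtain rfl : a.length = n := by simpa using hl
    have hll : a'.length = a.length := by simpa using hl'
    have hc := (isCAsc_concat.1 ha).1
    have hc' := (isCAsc_concat.1 ha').1
    obtain ⟨hw, hm, hspec⟩ := hc.fAS_spec
    obtain ⟨hw', hm', hspec'⟩ := hc'.fAS_spec
    rw [hll] at hw'
    obtain ⟨hb, hs⟩ := (hspec b).1 ha
    obtain ⟨hb', hs'⟩ := (hspec' b').1 ha'
    rw [fAS_concat, fAS_concat, insertMax_eq hw.1 hb, insertMax_eq hw'.1 hb'] at he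
    have hnot : ∀ {w : List ℕ}, w ∈ Perms a.length → a.length + 1 ∉ w := fun h h' => by
      have := (mem_iff_of_mem_perms h _).1 h'
      omega
    have herase : ∀ {w : List ℕ} {i : ℕ}, w ∈ Perms a.length → i ≤ w.length →
        (w.insertIdx i (a.length + 1)).erase (a.length + 1) = w := fun {w i} h h' => by
      rw [insertIdx_eq_take_append_cons_drop _ h',
        List.erase_append_right _ fun h'' => hnot h (List.mem_of_mem_take h''),
        List.erase_cons_head, List.take_append_drop]
    have hww : fAS a = fAS a' := by
      rw [← herase hw.1 hs.1, he, herase hw'.1 hs'.1]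
    obtain rfl : a = a' := ih ⟨rfl, hc⟩ ⟨hll, hc'⟩ hww
    have := List.injOn_insertIdx_index_of_notMem _ _ (hnot hw.1) hs.1 hs'.1 he
    rw [(pairwise_activeSites _).sortedLT.nodup.getElem_inj_iff] at this
    rw [this]

/-- The site vacated by the maximum splits the rest, so it is active; its label is an admissible
letter by `IsCAsc.fAS_spec`. -/
theorem fAS_surjOn (n : ℕ) : Set.SurjOn fAS (CAsc n) (CPerms n) := by
  induction n with
  | zero =>
    rintro w ⟨hw, -⟩
    exact ⟨[], ⟨rfl, IsCAsc.nil⟩, (List.length_eq_zero_iff.1 (length_of_mem_perms hw)).symm⟩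
  | succ n ih =>
    intro w' hw'
    obtain ⟨w, i, hi, rfl⟩ := exists_eq_insertIdx_of_mem_perms hw'.1
    obtain ⟨hw, hs⟩ := (insertIdx_mem_cPerms_iff hi).1 hw'
    obtain ⟨a, ⟨rfl, ha⟩, rfl⟩ := ih hw
    obtain ⟨b, hb, rfl⟩ := List.getElem_of_mem (mem_activeSites.2 ⟨hi, hs.isActive hw.1⟩)
    obtain ⟨-, -, hspec⟩ := IsCAsc.fAS_spec ha
    exact ⟨a ++ [b], ⟨by simp, (hspec b).2 ⟨hb, hs⟩⟩, by rw [fAS_concat, insertMax_eq hw.1 hb]⟩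

end AscentSeq

theorem mainTheorem6 (n : ℕ) :
    (∀ a ∈ AscentSeq.CAsc n, ∀ (k : ℕ) (hk : k < a.length),
      a[k] < (AscentSeq.activeSites (AscentSeq.fAS (a.take k))).length) ∧
    Set.BijOn AscentSeq.fAS (AscentSeq.CAsc n) (AscentSeq.CPerms n) := by
  refine ⟨?_, ?_, AscentSeq.fAS_injOn n, AscentSeq.fAS_surjOn n⟩
  · rintro a ⟨-, ha⟩ k hk
    change AscentSeq.IsCAsc a at ha
    have h := ha.take (k + 1)
    rw [List.take_succ_eq_append_getElem hk] at h
    exact (((ha.take k).fAS_spec.2.2 _).1 h).1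
  · rintro a ⟨rfl, ha⟩
    exact (AscentSeq.IsCAsc.fAS_spec ha).1
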